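/- Consider ten qubits $1,\dots,10$ with the non-interacting Hamiltonian $H=\sum_{l=1}^{10}\tilde H_l$, where $\tilde H_l=\mathbf I\otimes\cdots\otimes H_l\otimes\cdots\otimes\mathbf I$ acts as $H_l=\sum_{i=0}^{1}(E_l+i\alpha_l)|i\rangle\langle i|$ on the $l$-th qubit and $E_l\in\mathbb R$. One qubit, the central one, has gap $\alpha_c>0$, and each of the other nine has the same gap $\alpha>\alpha_c$. For a state $\rho$ of a system with Hamiltonian $K$ write $E(\rho)=\operatorname{Tr}[\rho K]$ for the mean energy and $W(\rho)=\operatorname{Tr}[\rho K]-\min_U\operatorname{Tr}[U\rho U^\dagger K]$ for the ergotropy, the minimum being over all unitaries $U$. For a ten-qubit state $\rho$ with marginals $\rho_1$ (of qubit $1$, Hamiltonian $H_1$) and $\rho_{1^c}$ (of the qubits $2,\dots,10$, with the sum of their local Hamiltonians as Hamiltonian), put $$\Delta_{1|1^c}=W(\rho)-W(\rho_1)-E(\rho_{1^c})+E_g^{1^c},$$ where $E_g^{1^c}$ is the ground state energy of the Hamiltonian of the qubits $2,\dots,10$. Then every ten-qubit state $\rho$ that is separable across the bipartition of qubit $1$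 versus the rest (that is, a finite probabilistic mixture of products of a state of qubit $1$ and a state of the qubits $2,\dots,10$) satisfies $$\Delta_{1|1^c}\le 0\quad\text{if qubit } 1 \text{ is the central qubit (so } \alpha_1=\alpha_c<\alpha_j=\alpha \text{ for all } j\ne 1),$$ $$\Delta_{1|1^c}\le\frac{\alpha-\alpha_c}{2}\quad\text{if } \alpha_1=\alpha.$$ -/

import Mathlib

open scoped Matrix Kronecker ComplexOrder

/-! Operators on the Hilbert space `(ℂ²)^{⊗ ι}` of a finite family `ι` of qubits are written as
matrices in the computational basis, whose vectors are indexed by bit strings `ι → Fin 2`. -/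

/-- Operators on the register of the qubits in `ι`. -/
abbrev QubitOp (ι : Type) : Type := Matrix (ι → Fin 2) (ι → Fin 2) ℂ

/-- Density operators: positive semidefinite with unit trace. -/
def IsDensity {n : Type} [Fintype n] (ρ : Matrix n n ℂ) : Prop :=
  ρ.PosSemidef ∧ ρ.trace = 1

/-- The tensor product `⨂ j, A j` of one-qubit operators. -/
def tensorOp {ι : Type} [Fintype ι] (A : ι → Matrix (Fin 2) (Fin 2) ℂ) : QubitOp ι :=
  Matrix.of fun s t => ∏ j, A j (s j) (t j)

/-- The one-qubit Hamiltonian `∑ i, (E + i α) |i⟩⟨i|`. -/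
noncomputable def qubitHamiltonian (E α : ℝ) : Matrix (Fin 2) (Fin 2) ℂ :=
  Matrix.diagonal fun i => ((E + ((i : ℕ) : ℝ) * α : ℝ) : ℂ)

/-- The non-interacting Hamiltonian `∑ l, I ⊗ ⋯ ⊗ I ⊗ H_l ⊗ I ⊗ ⋯ ⊗ I`, where `H_l` has ground
energy `E l` and gap `α l`. -/
noncomputable def hamiltonian {ι : Type} [Fintype ι] [DecidableEq ι] (E α : ι → ℝ) : QubitOp ι :=
  ∑ l, tensorOp (Function.update (fun _ => 1) l (qubitHamiltonian (E l) (α l)))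

/-- The mean energy `Tr[ρ H]` (a real number for Hermitian `ρ` and `H`). -/
noncomputable def energy {n : Type} [Fintype n] (H ρ : Matrix n n ℂ) : ℝ :=
  (ρ * H).trace.re

/-- The set of all mean energies `Tr[U ρ U† H]`, with `U` unitary. -/
def unitaryEnergies {n : Type} [Fintype n] [DecidableEq n] (H ρ : Matrix n n ℂ) : Set ℝ :=
  {e | ∃ U ∈ Matrix.unitaryGroup n ℂ, e = energy H (U * ρ * Uᴴ)}

/-- The ergotropy `Tr[ρ H] - min_U Tr[U ρ U† H]`, the minimum being over all unitaries. -/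
noncomputable def ergotropy {n : Type} [Fintype n] [DecidableEq n] (H ρ : Matrix n n ℂ) : ℝ :=
  energy H ρ - sInf (unitaryEnergies H ρ)

/-- The infimum in the definition of the ergotropy is a minimum. -/
theorem isLeast_unitaryEnergies {n : Type} [Fintype n] [DecidableEq n] (H ρ : Matrix n n ℂ) :
    IsLeast (unitaryEnergies H ρ) (sInf (unitaryEnergies H ρ)) := by
  have hcl : IsClosed {U : Matrix n n ℂ | U ∈ Matrix.unitaryGroup n ℂ} := by
    have : {U : Matrix n n ℂ | U ∈ Matrix.unitaryGroup n ℂ} = {U | U * Uᴴ = 1} := by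
      ext U
      exact Matrix.mem_unitaryGroup_iff
    rw [this]
    exact isClosed_eq (continuous_id.matrix_mul continuous_id.matrix_conjTranspose) continuous_const
  have hK : IsCompact {U : Matrix n n ℂ | U ∈ Matrix.unitaryGroup n ℂ} := by
    refine IsCompact.of_isClosed_subset (isCompact_univ_pi fun _ : n =>
      isCompact_univ_pi fun _ : n => isCompact_closedBall (0 : ℂ) 1) hcl ?_
    intro U hU i _ j _
    simpa using entry_norm_bound_of_unitary hU i j
  have him : unitaryEnergies H ρ =
      (fun U : Matrix n n ℂ => energy H (U * ρ * Uᴴ)) ''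
        {U : Matrix n n ℂ | U ∈ Matrix.unitaryGroup n ℂ} := by
    ext e
    constructor
    · rintro ⟨U, hU, rfl⟩
      exact ⟨U, hU, rfl⟩
    · rintro ⟨U, hU, rfl⟩
      exact ⟨U, hU, rfl⟩
  have hc : Continuous fun U : Matrix n n ℂ => energy H (U * ρ * Uᴴ) := by
    have h1 : Continuous fun U : Matrix n n ℂ => U * ρ * Uᴴ * H :=
      ((continuous_id.matrix_mul continuous_const).matrix_mul
        continuous_id.matrix_conjTranspose).matrix_mul continuous_const
    exact Complex.continuous_re.comp h1.matrix_trace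
  rw [him]
  exact (hK.image hc).isLeast_sInf (Set.Nonempty.image _ ⟨1, (Matrix.unitaryGroup n ℂ).one_mem⟩)

/-- The ground state energy of a Hermitian `H`: its smallest eigenvalue. -/
noncomputable def groundEnergy {n : Type} [Fintype n] [DecidableEq n] (H : Matrix n n ℂ) : ℝ :=
  sInf (spectrum ℝ H)

section Bipartition

variable {ι : Type} [DecidableEq ι]

/-- An operator on the whole register, seen as an operator on the tensor product of the
register of the qubits in `X` and the register of the remaining qubits. -/
def bipartite (X : Finset ι) (ρ : QubitOp ι) :
    Matrix (({i // i ∈ X} → Fin 2) × ({i // i ∉ X} → Fin 2))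
      (({i // i ∈ X} → Fin 2) × ({i // i ∉ X} → Fin 2)) ℂ :=
  Matrix.reindex (Equiv.piEquivPiSubtypeProd (fun i => i ∈ X) fun _ => Fin 2)
    (Equiv.piEquivPiSubtypeProd (fun i => i ∈ X) fun _ => Fin 2) ρ

variable [Fintype ι]

/-- The reduced operator on `X`: the partial trace over the qubits outside `X`. -/
def reducedIn (X : Finset ι) (ρ : QubitOp ι) : QubitOp {i // i ∈ X} :=
  Matrix.of fun a a' => ∑ b, bipartite X ρ (a, b) (a', b)

/-- The reduced operator on the complement of `X`: the partial trace over the qubits in `X`. -/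
def reducedOut (X : Finset ι) (ρ : QubitOp ι) : QubitOp {i // i ∉ X} :=
  Matrix.of fun b b' => ∑ a, bipartite X ρ (a, b) (a, b')

/-- `ρ` is separable across the cut `X` versus its complement: it is a probabilistic mixture of
finitely many products of a state on `X` and a state on the complement. -/
def IsSeparableAcross (X : Finset ι) (ρ : QubitOp ι) : Prop :=
  ∃ (k : ℕ) (p : Fin k → ℝ) (σ : Fin k → QubitOp {i // i ∈ X})
    (τ : Fin k → QubitOp {i // i ∉ X}),
    (∀ r, 0 ≤ p r) ∧ ∑ r, p r = 1 ∧ (∀ r, IsDensity (σ r)) ∧ (∀ r, IsDensity (τ r)) ∧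
      bipartite X ρ = ∑ r, (p r : ℂ) • (σ r ⊗ₖ τ r)

/-- `Δ_{X|Xᶜ} = W(ρ) - W(ρ_X) - E(ρ_{Xᶜ}) + E_g^{Xᶜ}` for the non-interacting system with local
ground energies `E` and gaps `α`. -/
noncomputable def ergotropyDelta (E α : ι → ℝ) (X : Finset ι) (ρ : QubitOp ι) : ℝ :=
  ergotropy (hamiltonian E α) ρ
    - ergotropy (hamiltonian (fun i : {i // i ∈ X} => E i) fun i => α i) (reducedIn X ρ)
    - energy (hamiltonian (fun i : {i // i ∉ X} => E i) fun i => α i) (reducedOut X ρ)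
    + groundEnergy (hamiltonian (fun i : {i // i ∉ X} => E i) fun i => α i)

end Bipartition

/-! Write `P(·)` for the minimal energy over unitaries, `m` for the smallest gap and `M` for the
largest eigenvalue of `ρ₁`. Local energies add up across the cut (`energy_hamiltonian_cut`), so mean
energies cancel and `Δ = P(ρ₁) - P(ρ) + E_g`. For one qubit, `P(ρ₁) = E₁ + (1 - M) α₁`. Separability
gives `ρ ≤ ρ₁ ⊗ 1 ≤ M`, so no unitary puts more than `M` on the ground level, and the rest of the
weight costs at least `m` (`le_sInf_unitaryEnergies`). Hence `Δ ≤ (1 - M)(α₁ - m)`, and `M ≥ 1/2`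
because `ρ₁` has two eigenvalues of sum 1. -/

/-! ### Levels of the diagonal Hamiltonian -/

/-- The energy of the computational basis vector `s`. -/
noncomputable def levelEnergy {ι : Type} [Fintype ι] (E α : ι → ℝ) (s : ι → Fin 2) : ℝ :=
  ∑ l, (E l + ((s l : ℕ) : ℝ) * α l)

theorem tensorOp_update_one_diagonal {ι : Type} [Fintype ι] [DecidableEq ι] (l : ι)
    (d : Fin 2 → ℂ) :
    tensorOp (Function.update (fun _ => 1) l (Matrix.diagonal d)) =
      Matrix.diagonal fun s => d (s l) := by
  ext s t
  simp only [tensorOp, Matrix.of_apply]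
  by_cases h : s = t
  · subst h
    rw [Matrix.diagonal_apply_eq, Finset.prod_eq_single l]
    · simp
    · intro j _ hj
      simp [Function.update_of_ne hj]
    · simp
  · rw [Matrix.diagonal_apply_ne _ h]
    obtain ⟨j, hj⟩ := Function.ne_iff.mp h
    refine Finset.prod_eq_zero (Finset.mem_univ j) ?_
    by_cases hjl : j = l
    · subst hjl
      simp [Matrix.diagonal_apply_ne _ hj]
    · simp [Function.update_of_ne hjl, Matrix.one_apply_ne hj]

theorem hamiltonian_eq_diagonal {ι : Type} [Fintype ι] [DecidableEq ι] (E α : ι → ℝ) :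
    hamiltonian E α = Matrix.diagonal fun s => (levelEnergy E α s : ℂ) := by
  unfold hamiltonian qubitHamiltonian
  simp_rw [tensorOp_update_one_diagonal]
  ext s t
  rw [Matrix.sum_apply]
  by_cases h : s = t
  · subst h
    simp [levelEnergy]
  · simp [Matrix.diagonal_apply_ne _ h]

theorem energy_diagonal {n : Type} [Fintype n] [DecidableEq n] (h : n → ℝ) (ρ : Matrix n n ℂ) :
    energy (Matrix.diagonal fun s => (h s : ℂ)) ρ = ∑ s, (ρ s s).re * h s := by
  simp [energy, Matrix.trace, Matrix.mul_diagonal]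

theorem energy_hamiltonian {ι : Type} [Fintype ι] [DecidableEq ι] (E α : ι → ℝ) (ρ : QubitOp ι) :
    energy (hamiltonian E α) ρ = ∑ s, (ρ s s).re * levelEnergy E α s := by
  rw [hamiltonian_eq_diagonal, energy_diagonal]

theorem levelEnergy_zero {ι : Type} [Fintype ι] (E α : ι → ℝ) :
    levelEnergy E α 0 = ∑ l, E l := by
  simp [levelEnergy]

/-- An excited level lies above the ground level by at least the smallest gap. -/
theorem sum_add_le_levelEnergy {ι : Type} [Fintype ι] {E α : ι → ℝ} {m : ℝ} (hm : 0 ≤ m)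
    (hα : ∀ l, m ≤ α l) {s : ι → Fin 2} (hs : s ≠ 0) :
    ∑ l, E l + m ≤ levelEnergy E α s := by
  obtain ⟨j, hj⟩ := Function.ne_iff.mp hs
  have hj1 : s j = 1 := by
    have : s j ≠ 0 := hj
    omega
  rw [levelEnergy, Finset.sum_add_distrib]
  have h0 : ∀ l ∈ Finset.univ, 0 ≤ ((s l : ℕ) : ℝ) * α l := fun l _ =>
    mul_nonneg (Nat.cast_nonneg _) (hm.trans (hα l))
  have h1 := Finset.single_le_sum h0 (Finset.mem_univ j)
  rw [hj1] at h1
  have := hα j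
  norm_num at h1
  linarith

/-- The ground energy enters `Δ` with a plus sign, so an upper bound suffices; the all-zero level
gives one whatever the signs of the gaps. -/
theorem groundEnergy_hamiltonian_le {ι : Type} [Fintype ι] [DecidableEq ι] (E α : ι → ℝ) :
    groundEnergy (hamiltonian E α) ≤ ∑ l, E l := by
  rw [hamiltonian_eq_diagonal, groundEnergy, ← levelEnergy_zero E α]
  refine csInf_le (Matrix.finite_real_spectrum (𝕜 := ℂ)).bddBelow ?_
  rw [← spectrum.preimage_algebraMap ℂ, Set.mem_preimage, spectrum_diagonal]
  exact ⟨0, rfl⟩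

/-! ### Eigenvalue bounds and minimal energies over unitaries -/

/-- An operator with eigenvalues at most `M` is at most `M`. -/
theorem Matrix.IsHermitian.posSemidef_smul_one_sub {n : Type} [Fintype n] [DecidableEq n]
    {A : Matrix n n ℂ} (hA : A.IsHermitian) {M : ℝ} (h : ∀ i, hA.eigenvalues i ≤ M) :
    ((M : ℂ) • (1 : Matrix n n ℂ) - A).PosSemidef := by
  have hd : (Matrix.diagonal fun i => ((M - hA.eigenvalues i : ℝ) : ℂ)).PosSemidef :=
    Matrix.PosSemidef.diagonal fun i => by
      simpa using h i
  have hV := hd.mul_mul_conjTranspose_same (hA.eigenvectorUnitary : Matrix n n ℂ)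
  convert hV using 1
  have hs := hA.spectral_theorem
  rw [Unitary.conjStarAlgAut_apply, Matrix.star_eq_conjTranspose] at hs
  have hu : (hA.eigenvectorUnitary : Matrix n n ℂ) * (hA.eigenvectorUnitary : Matrix n n ℂ)ᴴ = 1 :=
    Matrix.mem_unitaryGroup_iff.mp hA.eigenvectorUnitary.2
  have hdiag : (Matrix.diagonal fun i => ((M - hA.eigenvalues i : ℝ) : ℂ)) =
      (M : ℂ) • (1 : Matrix n n ℂ) - Matrix.diagonal (RCLike.ofReal ∘ hA.eigenvalues) := by
    ext i j
    by_cases hij : i = j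
    · subst hij; simp
    · simp [hij]
  rw [hdiag, Matrix.mul_sub, Matrix.sub_mul, ← hs, Matrix.mul_smul, Matrix.mul_one,
    Matrix.smul_mul, hu]

theorem Matrix.IsHermitian.sum_eigenvalues_eq_one {n : Type} [Fintype n] [DecidableEq n]
    {A : Matrix n n ℂ} (hA : A.IsHermitian) (ht : A.trace = 1) : ∑ i, hA.eigenvalues i = 1 := by
  have h := hA.trace_eq_sum_eigenvalues
  rw [ht] at h
  refine Complex.ofReal_injective ?_
  rw [Complex.ofReal_sum, Complex.ofReal_one]
  exact h.symm

theorem IsDensity.posSemidef_one_sub {n : Type} [Fintype n] [DecidableEq n]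
    {τ : Matrix n n ℂ} (hτ : IsDensity τ) : (1 - τ).PosSemidef := by
  have h := hτ.1.isHermitian.posSemidef_smul_one_sub (M := 1) fun i => by
    rw [← hτ.1.isHermitian.sum_eigenvalues_eq_one hτ.2]
    exact Finset.single_le_sum (fun j _ => hτ.1.eigenvalues_nonneg j) (Finset.mem_univ i)
  simpa using h

/-- The eigenvalues can be distributed over the levels of a diagonal Hamiltonian in any order. -/
theorem Matrix.IsHermitian.sum_eigenvalues_mem_unitaryEnergies {n : Type} [Fintype n]
    [DecidableEq n] {A : Matrix n n ℂ} (hA : A.IsHermitian) (h : n → ℝ) (σ : Equiv.Perm n) :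
    ∑ s, hA.eigenvalues (σ s) * h s ∈
      unitaryEnergies (Matrix.diagonal fun s => (h s : ℂ)) A := by
  set V : Matrix n n ℂ := (hA.eigenvectorUnitary : Matrix n n ℂ) with hVdef
  have hVV : Vᴴ * V = 1 := Matrix.mem_unitaryGroup_iff'.mp hA.eigenvectorUnitary.2
  have hVA : Vᴴ * A * V = Matrix.diagonal (RCLike.ofReal ∘ hA.eigenvalues) := by
    have := hA.conjStarAlgAut_star_eigenvectorUnitary
    rw [Unitary.conjStarAlgAut_star_apply] at this
    exact this
  -- Taken for a general `B`: `B = 1` yields unitarity, `B = A` the permuted diagonal.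
  have key : ∀ B : Matrix n n ℂ, Vᴴ.submatrix σ id * B * (Vᴴ.submatrix σ id)ᴴ =
      (Vᴴ * B * V).submatrix σ σ := by
    intro B
    ext i j
    simp [Matrix.mul_apply]
  refine ⟨Vᴴ.submatrix σ id, ?_, ?_⟩
  · rw [Matrix.mem_unitaryGroup_iff, Matrix.star_eq_conjTranspose]
    have := key 1
    rw [Matrix.mul_one, Matrix.mul_one, hVV] at this
    rw [this]
    simp
  · rw [key, hVA, energy_diagonal]
    simp

theorem levelEnergy_unique {κ : Type} [Fintype κ] [Unique κ] (E α : κ → ℝ) (s : κ → Fin 2) :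
    levelEnergy E α s = E default + ((s default : ℕ) : ℝ) * α default := by
  simp [levelEnergy]

/-- Passive energy of one qubit: the eigenvalue `i` may be placed on the ground level. -/
theorem sInf_unitaryEnergies_le {κ : Type} [Fintype κ] [DecidableEq κ] [Unique κ] (E α : κ → ℝ)
    {A : QubitOp κ} (hA : A.IsHermitian) (ht : A.trace = 1) (i : κ → Fin 2) :
    sInf (unitaryEnergies (hamiltonian E α) A) ≤
      E default + (1 - hA.eigenvalues i) * α default := by
  -- The swap puts eigenvalue `i` on level `0`; the other one, which is `1` minus it, lands on the
  -- excited level.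
  have hmem := hA.sum_eigenvalues_mem_unitaryEnergies (levelEnergy E α) (Equiv.swap i 0)
  rw [← hamiltonian_eq_diagonal] at hmem
  refine ((isLeast_unitaryEnergies _ _).2 hmem).trans_eq ?_
  have h1 := hA.sum_eigenvalues_eq_one ht
  rw [← Equiv.sum_comp (Equiv.swap i 0)] at h1
  have hsum : ∀ f : (κ → Fin 2) → ℝ, ∑ s, f s = f 0 + f 1 := by
    intro f
    rw [← Equiv.sum_comp (Equiv.funUnique κ (Fin 2)).symm, Fin.sum_univ_two]
    rfl
  rw [hsum] at h1 ⊢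
  rw [Equiv.swap_apply_right] at h1 ⊢
  rw [levelEnergy_unique, levelEnergy_unique]
  simp only [Pi.zero_apply, Pi.one_apply, Fin.val_zero, Fin.val_one, Nat.cast_zero, Nat.cast_one]
  linear_combination (E default + α default) * h1

/-- If `ρ ≤ M`, then no unitary brings the energy below that of a state with weight `M` on the
ground level and the rest on a level separated by the smallest gap `m`. -/
theorem le_sInf_unitaryEnergies {ι : Type} [Fintype ι] [DecidableEq ι] {E α : ι → ℝ} {m M : ℝ}
    (hm : 0 ≤ m) (hα : ∀ l, m ≤ α l) {ρ : QubitOp ι} (hρ : IsDensity ρ)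
    (hM : ((M : ℂ) • (1 : QubitOp ι) - ρ).PosSemidef) :
    ∑ l, E l + (1 - M) * m ≤ sInf (unitaryEnergies (hamiltonian E α) ρ) := by
  obtain ⟨U, hU, hE⟩ := (isLeast_unitaryEnergies (hamiltonian E α) ρ).1
  rw [hE, energy_hamiltonian]
  have hUU : U * Uᴴ = 1 := Matrix.mem_unitaryGroup_iff.mp hU
  have hUU' : Uᴴ * U = 1 := Matrix.mem_unitaryGroup_iff'.mp hU
  have hpos : ∀ s, 0 ≤ ((U * ρ * Uᴴ) s s).re := fun s =>
    (Complex.le_def.mp ((hρ.1.mul_mul_conjTranspose_same U).diag_nonneg (i := s))).1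
  have htr : ∑ s, ((U * ρ * Uᴴ) s s).re = 1 := by
    have h : (U * ρ * Uᴴ).trace = 1 := by
      rw [Matrix.trace_mul_comm, ← Matrix.mul_assoc, hUU', Matrix.one_mul, hρ.2]
    have h' := congrArg Complex.re h
    simpa [Matrix.trace] using h'
  have h0 : ((U * ρ * Uᴴ) 0 0).re ≤ M := by
    have h := (hM.mul_mul_conjTranspose_same U).diag_nonneg (i := 0)
    rw [Matrix.mul_sub, Matrix.sub_mul, Matrix.mul_smul, Matrix.mul_one, Matrix.smul_mul, hUU] at h
    simpa using (Complex.le_def.mp h).1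
  -- Every level is charged the gap `m`, which is then refunded to the ground level, whose
  -- population is at most `M`.
  have hlow : ∀ s ∈ Finset.univ, ((U * ρ * Uᴴ) s s).re * (∑ l, E l + m) -
      (if s = 0 then ((U * ρ * Uᴴ) s s).re * m else 0) ≤
        ((U * ρ * Uᴴ) s s).re * levelEnergy E α s := by
    intro s _
    split_ifs with hs
    · subst hs
      rw [levelEnergy_zero]
      linarith
    · rw [sub_zero]
      exact mul_le_mul_of_nonneg_left (sum_add_le_levelEnergy hm hα hs) (hpos s)
  refine le_trans ?_ (Finset.sum_le_sum hlow)
  rw [Finset.sum_sub_distrib, ← Finset.sum_mul, htr, Finset.sum_ite_eq' Finset.univ 0,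
    if_pos (Finset.mem_univ _)]
  nlinarith [mul_le_mul_of_nonneg_right h0 hm]

/-! ### The bipartition and separability -/

section Cut

variable {ι : Type} [DecidableEq ι] [Fintype ι]

theorem Fintype.sum_mem_add_sum_not_mem (X : Finset ι) (f : ι → ℝ) :
    ∑ l, f l = ∑ i : {i // i ∈ X}, f i + ∑ i : {i // i ∉ X}, f i := by
  convert (Fintype.sum_subtype_add_sum_subtype (fun i => i ∈ X) f).symm

theorem levelEnergy_cut (X : Finset ι) (E α : ι → ℝ) (a : {i // i ∈ X} → Fin 2)
    (b : {i // i ∉ X} → Fin 2) :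
    levelEnergy E α ((Equiv.piEquivPiSubtypeProd (fun i => i ∈ X) fun _ => Fin 2).symm (a, b)) =
      levelEnergy (fun i : {i // i ∈ X} => E i) (fun i => α i) a +
        levelEnergy (fun i : {i // i ∉ X} => E i) (fun i => α i) b := by
  unfold levelEnergy
  rw [Fintype.sum_mem_add_sum_not_mem X]
  congr 1
  · refine Finset.sum_congr rfl fun i _ => ?_
    simp [Equiv.piEquivPiSubtypeProd, i.2]
  · refine Finset.sum_congr rfl fun i _ => ?_
    simp [Equiv.piEquivPiSubtypeProd, i.2]

theorem energy_hamiltonian_cut (X : Finset ι) (E α : ι → ℝ) (ρ : QubitOp ι) :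
    energy (hamiltonian E α) ρ =
      energy (hamiltonian (fun i : {i // i ∈ X} => E i) fun i => α i) (reducedIn X ρ) +
        energy (hamiltonian (fun i : {i // i ∉ X} => E i) fun i => α i) (reducedOut X ρ) := by
  simp only [energy_hamiltonian]
  rw [← Equiv.sum_comp (Equiv.piEquivPiSubtypeProd (fun i => i ∈ X) fun _ => Fin 2).symm,
    Fintype.sum_prod_type]
  simp only [levelEnergy_cut, mul_add, Finset.sum_add_distrib]
  congr 1
  · refine Finset.sum_congr rfl fun a _ => ?_
    simp [reducedIn, bipartite, Finset.sum_mul]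
  · rw [Finset.sum_comm]
    refine Finset.sum_congr rfl fun a _ => ?_
    simp [reducedOut, bipartite, Finset.sum_mul]

theorem trace_reducedIn (X : Finset ι) (ρ : QubitOp ι) : (reducedIn X ρ).trace = ρ.trace := by
  unfold Matrix.trace
  rw [← Equiv.sum_comp (Equiv.piEquivPiSubtypeProd (fun i => i ∈ X) fun _ => Fin 2).symm,
    Fintype.sum_prod_type]
  simp [reducedIn, bipartite]

theorem isHermitian_reducedIn (X : Finset ι) {ρ : QubitOp ι} (hρ : ρ.IsHermitian) :
    (reducedIn X ρ).IsHermitian := by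
  ext a a'
  simp only [reducedIn, bipartite, Matrix.conjTranspose_apply, Matrix.of_apply, star_sum,
    Matrix.reindex_apply, Matrix.submatrix_apply]
  exact Finset.sum_congr rfl fun b _ => hρ.apply _ _

/-- A state separable across the cut is dominated by its marginal on `X`. -/
theorem IsSeparableAcross.posSemidef_reducedIn_sub {X : Finset ι} {ρ : QubitOp ι}
    (h : IsSeparableAcross X ρ) :
    (reducedIn X ρ ⊗ₖ (1 : QubitOp {i // i ∉ X}) - bipartite X ρ).PosSemidef := by
  obtain ⟨k, p, σ, τ, hp, -, hσ, hτ, hb⟩ := h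
  have hred : reducedIn X ρ = ∑ r, (p r : ℂ) • σ r := by
    ext a a'
    simp only [reducedIn, hb, Matrix.of_apply, Matrix.sum_apply, Matrix.smul_apply,
      Matrix.kronecker_apply, smul_eq_mul]
    rw [Finset.sum_comm]
    refine Finset.sum_congr rfl fun r _ => ?_
    rw [← Finset.mul_sum, ← Finset.mul_sum]
    have : ∑ b, τ r b b = 1 := (hτ r).2
    rw [this, mul_one]
  -- Term by term, `σ ⊗ 1 - σ ⊗ τ = σ ⊗ (1 - τ)`, a product of positive operators since `τ ≤ 1`.
  have heq : reducedIn X ρ ⊗ₖ (1 : QubitOp {i // i ∉ X}) - bipartite X ρ =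
      ∑ r, (p r : ℂ) • (σ r ⊗ₖ (1 - τ r)) := by
    rw [hred, hb]
    ext ⟨a, b⟩ ⟨a', b'⟩
    simp only [Matrix.sub_apply, Matrix.sum_apply, Matrix.smul_apply, Matrix.kronecker_apply,
      smul_eq_mul, Finset.sum_mul, ← Finset.sum_sub_distrib]
    exact Finset.sum_congr rfl fun r _ => by ring
  rw [heq]
  refine Matrix.posSemidef_sum _ fun r _ => ?_
  exact ((hσ r).1.kronecker (hτ r).posSemidef_one_sub).smul (by simpa using hp r)

/-- Any bound on the marginal of a separable state is a bound on the state. -/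
theorem IsSeparableAcross.posSemidef_smul_one_sub {X : Finset ι} {ρ : QubitOp ι}
    (h : IsSeparableAcross X ρ) {M : ℝ}
    (hM : ((M : ℂ) • (1 : QubitOp {i // i ∈ X}) - reducedIn X ρ).PosSemidef) :
    ((M : ℂ) • (1 : QubitOp ι) - ρ).PosSemidef := by
  -- `M - ρ = (M - ρ_X) ⊗ 1 + (ρ_X ⊗ 1 - ρ)`.
  have h1 := (hM.kronecker (Matrix.PosSemidef.one (n := {i // i ∉ X} → Fin 2) (R := ℂ))).add
    h.posSemidef_reducedIn_sub
  have h2 := h1.submatrix (Equiv.piEquivPiSubtypeProd (fun i => i ∈ X) fun _ => Fin 2)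
  refine (congrArg Matrix.PosSemidef ?_).mpr h2
  ext s t
  have h3 := congrFun₂ (Matrix.one_kronecker_one (α := ℂ) (m := {i // i ∈ X} → Fin 2)
    (n := {i // i ∉ X} → Fin 2))
    (Equiv.piEquivPiSubtypeProd (fun i => i ∈ X) (fun _ => Fin 2) s)
    (Equiv.piEquivPiSubtypeProd (fun i => i ∈ X) (fun _ => Fin 2) t)
  have h4 : (1 : QubitOp ι) s t = (1 : Matrix _ _ ℂ)
      (Equiv.piEquivPiSubtypeProd (fun i => i ∈ X) (fun _ => Fin 2) s)
      (Equiv.piEquivPiSubtypeProd (fun i => i ∈ X) (fun _ => Fin 2) t) := by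
    simp only [Matrix.one_apply, EmbeddingLike.apply_eq_iff_eq]
  rw [← h3, Matrix.kronecker_apply] at h4
  simp only [bipartite, Matrix.sub_apply, Matrix.smul_apply, Matrix.submatrix_apply,
    Matrix.add_apply, Matrix.kroneckerMap_apply, Matrix.reindex_apply, Equiv.symm_apply_apply,
    smul_eq_mul, h4]
  ring

/-- For a state separable across one qubit versus the rest, `Δ` is at most half the excess of the
gap of that qubit over the smallest gap. -/
theorem ergotropyDelta_singleton_le (E gap : ι → ℝ) (i : ι) {m : ℝ} (hm : 0 < m)
    (hgap : ∀ j, m ≤ gap j) {ρ : QubitOp ι} (hρ : IsDensity ρ) (hsep : IsSeparableAcross {i} ρ) :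
    ergotropyDelta E gap {i} ρ ≤ (gap i - m) / 2 := by
  have hd : ((default : {j // j ∈ ({i} : Finset ι)}) : ι) = i :=
    Finset.mem_singleton.mp (default : {j // j ∈ ({i} : Finset ι)}).2
  have hH := isHermitian_reducedIn {i} hρ.1.isHermitian
  have ht : (reducedIn {i} ρ).trace = 1 := by rw [trace_reducedIn, hρ.2]
  have hgi : 0 < gap i := hm.trans_le (hgap i)
  set P := sInf (unitaryEnergies (hamiltonian (fun j : {j // j ∈ ({i} : Finset ι)} => E j)
    fun j => gap j) (reducedIn {i} ρ)) with hP
  -- `M` is read off from the minimal energy `P` of the qubit, so that `P = E i + (1 - M) * gap i`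
  -- holds by definition; only `eigenvalues ≤ M` then has to be shown.
  set M : ℝ := 1 - (P - E i) / gap i with hMdef
  have hPM : P = E i + (1 - M) * gap i := by
    rw [hMdef]
    field_simp
    ring
  have heig : ∀ s, hH.eigenvalues s ≤ M := by
    intro s
    have h := sInf_unitaryEnergies_le (fun j : {j // j ∈ ({i} : Finset ι)} => E j)
      (fun j => gap j) hH ht s
    rw [← hP, hPM, hd] at h
    have : (1 - M) * gap i ≤ (1 - hH.eigenvalues s) * gap i := by linarith
    have := le_of_mul_le_mul_right this hgi
    linarith
  have hhalf : 1 ≤ 2 * M := by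
    rw [← hH.sum_eigenvalues_eq_one ht]
    refine (Finset.sum_le_sum fun s _ => heig s).trans_eq ?_
    simp
  have hlow := le_sInf_unitaryEnergies (E := E) hm.le hgap hρ
    (hsep.posSemidef_smul_one_sub (hH.posSemidef_smul_one_sub heig))
  have hg := groundEnergy_hamiltonian_le (fun j : {j // j ∉ ({i} : Finset ι)} => E j)
    fun j => gap j
  have hsplit : ∑ j, E j = E i + ∑ j : {j // j ∉ ({i} : Finset ι)}, E j := by
    rw [Fintype.sum_mem_add_sum_not_mem {i}]
    congr 1
    rw [Fintype.sum_unique, hd]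
  have hcut := energy_hamiltonian_cut {i} E gap ρ
  unfold ergotropyDelta ergotropy
  rw [← hP]
  -- The bounds give `Δ ≤ (1 - M)(gap i - m)`; the product hint replaces `1 - M` by `1/2`.
  nlinarith [mul_nonneg (sub_nonneg.mpr (hgap i)) (sub_nonneg.mpr hhalf)]

end Cut

theorem proposition4
    -- local ground energies and gaps of the ten qubits; qubit 1 has index `0`
    (E gap : Fin 10 → ℝ)
    -- the position of the central qubit
    (c : Fin 10) (αc α : ℝ) (hαc : 0 < αc) (hα : αc < α)
    (hgapc : gap c = αc) (hgap : ∀ j, j ≠ c → gap j = α)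
    (ρ : QubitOp (Fin 10)) (hρ : IsDensity ρ)
    (hsep : IsSeparableAcross {(0 : Fin 10)} ρ) :
    (c = 0 → ergotropyDelta E gap {(0 : Fin 10)} ρ ≤ 0) ∧
    (gap 0 = α → ergotropyDelta E gap {(0 : Fin 10)} ρ ≤ (α - αc) / 2) := by
  have hmin : ∀ j, αc ≤ gap j := by
    intro j
    by_cases hj : j = c
    · rw [hj, hgapc]
    · rw [hgap j hj]
      exact hα.le
  -- Here `m = αc`: a central qubit 1 has no excess gap, any other has excess `α - αc`.
  have h := ergotropyDelta_singleton_le E gap 0 hαc hmin hρ hsep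
  refine ⟨fun hc => ?_, fun h0 => ?_⟩
  · rwa [← hc, hgapc, sub_self, zero_div, hc] at h
  · rwa [h0] at h
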